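/- **Setting.** Let $\mathcal D$ be a canonical one-parameter exponential family on $\mathbb R$, parametrized by its means, which form an interval $\Theta$ (with natural parameters in the interior of the natural parameter space). For $m,m'\in\Theta$ let $d(m,m')$ be the Kullback–Leibler divergence between the members with means $m,m'$; for an empirical mean $x\in\mathbb R$ let $d(x,m)\in[0,\infty]$ be its usual extension, the largest log-likelihood ratio per observation against the member of mean $m$ of a sample with average $x$. Let $\mathcal S$ be the set of $\lambda\in\mathbb R^K$ that have a unique maximal coordinate $i^\star(\lambda)$, are nondecreasing up to it and nonincreasing after it. Let $\mathcal N(i)\subseteq[K]$ be the set of arms at distance one from $i$. Fix an instance $\mu\in\mathcal S\cap\Theta^K$ and write $\star=i^\star(\mu)$. For $\lambda\in\mathcal S\cap\Theta^K$ with best arm $b$ and a weight vector $\omega$, let $g_i(\omega,\lambda)=\inf_{x\in(\lambda_i,\lambda_b)}\big(\omega_b d(\lambda_b,x)+\omega_i d(\lambda_i,x)\big)$, let $\widetilde\Delta_K(\lambda)$ be the set of probability vectors on $[K]$ supported on $\{b\}\cup\mathcal N(b)$, and let $T^\star(\lambda)^{-1}=\sup_{\omega\in\widetilde\Delta_K(\lambda)}\min_{i\in\mathcal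 N(b)}g_i(\omega,\lambda)$. **Algorithm (O-TaS).** Let $I_s$ and $X_s$ be the arm pulled and the observation in round $s\ge1$, and let $N_a(t)$ and $\hat\mu_a(t)$ be the number of pulls and the empirical mean of arm $a$ before round $t$. With a radius function $r$, let $\widetilde\Theta_t=\{\lambda\in\mathcal S\cap\Theta^K: N_i(t)\,d(\hat\mu_i(t),\lambda_i)\le r(t)\ \forall i\}$. O-TaS pulls each arm once in rounds $1,\dots,K$. In each round $t>K$ with $\widetilde\Theta_t\neq\emptyset$ it takes $\mu^+(t)\in\operatorname{argmax}_{\lambda\in\widetilde\Theta_t}T^\star(\lambda)^{-1}$, sets $i^+(t)=i^\star(\mu^+(t))$ and takes $\omega(t)\in\operatorname{argmax}_{\omega\in\widetilde\Delta_K(\mu^+(t))}\min_{i\in\mathcal N(i^+(t))}g_i(\omega,\mu^+(t))$; in all other rounds $\omega(t)$ is an arbitrary probability vector. In rounds $t>K$ it pulls $I_t\in\operatorname{argmax}_i\big(\sum_{s\le t}\omega_i(s)-N_i(t)\big)$. All ties are broken arbitrarily. **Assumptions.** (1) The natural parameters of any two members with means in $\Theta$ differ by at most a constant $M$. (2) There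 is $\sigma>0$ with $d(m,m')\ge (m'-m)^2/(2\sigma^2)$ for all $m,m'\in\Theta$. (3) $f:\mathbb N\to[0,\infty)$ is nondecreasing; the radius satisfies $r(t)\ge f(t)$ for all $t$ and $r(t)=o(t)$ (for example $r(t)=f(t)$, or $r(t)=f(t^2)$, with $f$ logarithmic). Let $$\mathcal E_n=\{\forall k\in[K],\ \forall t\le n:\ N_k(t)\,d(\hat\mu_k(t),\mu_k)\le f(n)\}.$$ **Theorem.** (i) If $f(t^2)\le r(t)$ for all $t$, there is a deterministic $T_0\in\mathbb N$, the same for all trajectories of O-TaS, such that for all $t\ge T_0$, on $\mathcal E_t$, $i^+(t)=\star$ and $\omega_a(t)=0$ for all $a\notin\mathcal N(\star)\cup\{\star\}$. (ii) Run O-TaS (without stopping) on a probability space where each $I_t$ is chosen from the past, $X_t$ given the past and $I_t$ has the law in $\mathcal D$ of mean $\mu_{I_t}$, and, for some constant $\gamma>0$, $\mathbb P(\mathcal E_n^{\complement})\le\gamma\,\log(n)/n^3$ for all $n\geq 1$. Then almost surely $\mathcal E_n$ holds for all large $n$, and there is a random time $T$ with values in $\mathbb N$ such that, on every outcome for which $\mathcal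 E_n$ holds for all large $n$ (hence almost surely), $$N_a(t)=N_a(T)\quad\text{for all } t\ge T\text{ and all } a\notin\mathcal N(\star)\cup\{\star\}.$$ -/

import Mathlib

open MeasureTheory ProbabilityTheory Filter Topology

/-! ### One-parameter exponential families -/

/-- A canonical one-parameter exponential family on the real line, parametrized by its means.
The member with natural parameter `η` has density proportional to `x ↦ exp (η * x)` with respect
to the base measure; `means` is the interval of means, and `natParam m` is the natural parameter
of the member with mean `m`. -/
structure ExpFamily where
  base : Measure ℝ
  base_ne_zero : base ≠ 0
  means : Set ℝ
  means_ordConnected : means.OrdConnected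
  natParam : ℝ → ℝ
  natParam_mem : ∀ m ∈ means, natParam m ∈ interior (integrableExpSet id base)
  mean_eq : ∀ m ∈ means, ∫ x, x ∂(base.tilted (fun x => natParam m * x)) = m

namespace ExpFamily

/-- The distribution of mean `m` in the family. -/
noncomputable def law (F : ExpFamily) (m : ℝ) : Measure ℝ :=
  F.base.tilted (fun x => F.natParam m * x)

/-- The divergence `d(m, m')`: the Kullback-Leibler divergence between the members of the family
with means `m` and `m'`. -/
noncomputable def kl (F : ExpFamily) (m m' : ℝ) : ℝ :=
  (InformationTheory.klDiv (F.law m) (F.law m')).toReal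

/-- The divergence `d(x, m)` when the first argument is an empirical mean, which need not be the
mean of a member of the family: the largest log-likelihood ratio per observation, against the
member with mean `m`, of a sample with average `x`. It is the usual (lower semicontinuous)
extension of the Kullback-Leibler divergence, see `empKL_eq_klDiv`. -/
noncomputable def empKL (F : ExpFamily) (x m : ℝ) : ENNReal :=
  ⨆ η ∈ interior (integrableExpSet id F.base),
    ENNReal.ofReal ((η - F.natParam m) * x - (cgf id F.base η - cgf id F.base (F.natParam m)))

/-- The Kullback-Leibler divergence between two members is finite, with the usual formula. -/
theorem klDiv_tilted (ρ : Measure ℝ) (hρ : ρ ≠ 0) {a b : ℝ}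
    (ha : a ∈ interior (integrableExpSet id ρ)) (hb : b ∈ interior (integrableExpSet id ρ)) :
    InformationTheory.klDiv (ρ.tilted (fun x => a * x)) (ρ.tilted (fun x => b * x)) ≠ ⊤ ∧
    (InformationTheory.klDiv (ρ.tilted (fun x => a * x)) (ρ.tilted (fun x => b * x))).toReal =
      (a - b) * (∫ x, x ∂(ρ.tilted (fun x => a * x))) - (cgf id ρ a - cgf id ρ b) := by
  have : NeZero ρ := ⟨hρ⟩
  have ha' : a ∈ integrableExpSet id ρ := interior_subset ha
  have hb' : b ∈ integrableExpSet id ρ := interior_subset hb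
  have ia : Integrable (fun x => Real.exp (a * x)) ρ := ha'
  have ib : Integrable (fun x => Real.exp (b * x)) ρ := hb'
  have pa := isProbabilityMeasure_tilted ia
  have pb := isProbabilityMeasure_tilted ib
  set μ := ρ.tilted (fun x => a * x) with hμ
  set ν := ρ.tilted (fun x => b * x) with hν
  have hμν : μ = ν.tilted (fun x => (a - b) * x) := by
    rw [hν, tilted_tilted ib, hμ]
    congr 1
    funext x
    simp only [Pi.add_apply]
    ring
  have hexp : ∫ x, Real.exp ((a - b) * x) ∂ν = Real.exp (cgf id ρ a - cgf id ρ b) := by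
    rw [hν, integral_exp_tilted]
    have e : ((fun x => b * x) + fun x => (a - b) * x) = fun x : ℝ => a * x := by
      funext x
      simp only [Pi.add_apply]
      ring
    rw [e, Real.exp_sub, exp_cgf (by exact ia), exp_cgf (by exact ib)]
    rfl
  have iexp : Integrable (fun x => Real.exp ((a - b) * x)) ν := by
    by_contra hcon
    rw [integral_undef hcon] at hexp
    exact (Real.exp_pos _).ne hexp
  have hac : μ ≪ ν := hμν ▸ tilted_absolutelyContinuous _ _
  have hll : llr μ ν =ᵐ[μ] fun x => (a - b) * x - (cgf id ρ a - cgf id ρ b) := by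
    apply hac.ae_eq
    have := log_rnDeriv_tilted_left_self iexp
    rw [← hμν] at this
    filter_upwards [this] with x hx
    rw [llr_def]
    simp only
    rw [hx, hexp, Real.log_exp]
  have hid : Integrable (fun x : ℝ => x) μ :=
    memLp_one_iff_integrable.mp (by exact_mod_cast memLp_tilted_mul ha 1)
  have hint : Integrable (llr μ ν) μ := by
    rw [integrable_congr hll]
    exact (hid.const_mul _).sub (integrable_const _)
  refine ⟨InformationTheory.klDiv_ne_top hac hint, ?_⟩
  rw [InformationTheory.toReal_klDiv_of_measure_eq hac (by simp), integral_congr_ae hll,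
    integral_sub (hid.const_mul _) (integrable_const _), integral_const_mul]
  simp

/-- The extension `empKL` agrees with the Kullback-Leibler divergence on the means. -/
theorem empKL_eq_klDiv (F : ExpFamily) {m m' : ℝ} (hm : m ∈ F.means) (hm' : m' ∈ F.means) :
    F.empKL m m' = InformationTheory.klDiv (F.law m) (F.law m') := by
  have h := klDiv_tilted F.base F.base_ne_zero (F.natParam_mem m hm) (F.natParam_mem m' hm')
  rw [F.mean_eq m hm] at h
  have e : InformationTheory.klDiv (F.law m) (F.law m') = ENNReal.ofReal
      ((F.natParam m - F.natParam m') * m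
        - (cgf id F.base (F.natParam m) - cgf id F.base (F.natParam m'))) := by
    rw [← h.2, ENNReal.ofReal_toReal h.1]
    rfl
  rw [e]
  apply le_antisymm
  · refine iSup₂_le fun η hη => ENNReal.ofReal_le_ofReal ?_
    have h2 := (klDiv_tilted F.base F.base_ne_zero (F.natParam_mem m hm) hη).2
    rw [F.mean_eq m hm] at h2
    have h3 := h2 ▸ ENNReal.toReal_nonneg
    linarith
  · exact le_iSup₂_of_le (F.natParam m) (F.natParam_mem m hm) le_rfl

end ExpFamily

/-! ### Unimodal instances and oracle weights -/

/-- The mean vector `v` is unimodal and its unique maximum is at arm `i`. -/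
def UnimodalAt {K : ℕ} (v : Fin K → ℝ) (i : Fin K) : Prop :=
  (∀ j, j ≠ i → v j < v i) ∧ MonotoneOn v (Set.Iic i) ∧ AntitoneOn v (Set.Ici i)

/-- The set of neighbouring arms of arm `i`. -/
def neighbors {K : ℕ} (i : Fin K) : Set (Fin K) :=
  {j | j.val + 1 = i.val ∨ i.val + 1 = j.val}

/-- The transportation cost `inf_{x ∈ (v i, v b)} (w b * d(v b, x) + w i * d(v i, x))`, where `b`
is the best arm of `v`. -/
noncomputable def transportCost {K : ℕ} (F : ExpFamily) (b : Fin K) (v w : Fin K → ℝ)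
    (i : Fin K) : ℝ :=
  sInf ((fun x => w b * F.kl (v b) x + w i * F.kl (v i) x) '' Set.Ioo (v i) (v b))

/-- The minimum of the transportation costs over the neighbours of the best arm `b` of `v`. -/
noncomputable def minCost {K : ℕ} (F : ExpFamily) (b : Fin K) (v w : Fin K → ℝ) : ℝ :=
  sInf (transportCost F b v w '' neighbors b)

/-- The weight vectors of the simplex that vanish outside of arm `b` and its neighbours. -/
def localSimplex {K : ℕ} (b : Fin K) : Set (Fin K → ℝ) :=
  {w | w ∈ stdSimplex ℝ (Fin K) ∧ ∀ a, a ≠ b → a ∉ neighbors b → w a = 0}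

/-- The inverse characteristic time of the unimodal vector `v` with best arm `b`. -/
noncomputable def invCharTime {K : ℕ} (F : ExpFamily) (b : Fin K) (v : Fin K → ℝ) : ℝ :=
  sSup (minCost F b v '' localSimplex b)

/-! ### Counts, empirical means and confidence regions along a trajectory

A trajectory is a sequence `I` of arms and a sequence `X` of observations; rounds are
numbered from `1`, and the value at index `0` is never used. -/

/-- The number of pulls of arm `a` before round `t`. -/
def pulls {K : ℕ} (I : ℕ → Fin K) (a : Fin K) (t : ℕ) : ℕ :=
  ((Finset.Ico 1 t).filter (fun s => I s = a)).card

/-- The empirical mean of arm `a` before round `t`. -/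
noncomputable def empMean {K : ℕ} (I : ℕ → Fin K) (X : ℕ → ℝ) (a : Fin K) (t : ℕ) : ℝ :=
  (∑ s ∈ (Finset.Ico 1 t).filter (fun s => I s = a), X s) / (pulls I a t : ℝ)

/-- The structured confidence region of radius `r t` at round `t`. -/
def structuredRegion {K : ℕ} (F : ExpFamily) (r : ℕ → ℝ) (I : ℕ → Fin K) (X : ℕ → ℝ) (t : ℕ) :
    Set (Fin K → ℝ) :=
  {v | (∀ i, v i ∈ F.means ∧
      (pulls I i t : ENNReal) * F.empKL (empMean I X i t) (v i) ≤ ENNReal.ofReal (r t)) ∧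
    ∃ b, UnimodalAt v b}

/-- The trajectory satisfies the concentration inequalities of radius `f n` up to round `n`. -/
def Concentrated {K : ℕ} (F : ExpFamily) (μ : Fin K → ℝ) (f : ℕ → ℝ) (I : ℕ → Fin K) (X : ℕ → ℝ)
    (n : ℕ) : Prop :=
  ∀ k, ∀ t ≤ n, (pulls I k t : ENNReal) * F.empKL (empMean I X k t) (μ k) ≤ ENNReal.ofReal (f n)

/-! ### Optimistic Track-and-Stop -/

/-- The trajectory `I`, `X` is produced by the sampling rule of Optimistic Track-and-Stop with
confidence radius `r`, where `w t` are the weights, `v t` the optimistic instance, and `b t` the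
optimistic best arm at round `t`. Every arm is pulled once in the first `K` rounds; when the
structured confidence region is empty, the weights are arbitrary. Ties are broken arbitrarily. -/
structure IsOTaSRun {K : ℕ} (F : ExpFamily) (r : ℕ → ℝ) (I : ℕ → Fin K) (X : ℕ → ℝ)
    (w v : ℕ → Fin K → ℝ) (b : ℕ → Fin K) : Prop where
  init : Set.BijOn I (Set.Icc 1 K) Set.univ
  simplex : ∀ t, 1 ≤ t → w t ∈ stdSimplex ℝ (Fin K)
  optimistic_mem : ∀ t, K < t → (structuredRegion F r I X t).Nonempty →
    v t ∈ structuredRegion F r I X t ∧ UnimodalAt (v t) (b t)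
  optimistic_max : ∀ t, K < t → ∀ u ∈ structuredRegion F r I X t, ∀ i, UnimodalAt u i →
    invCharTime F i u ≤ invCharTime F (b t) (v t)
  weights_mem : ∀ t, K < t → (structuredRegion F r I X t).Nonempty → w t ∈ localSimplex (b t)
  weights_max : ∀ t, K < t → (structuredRegion F r I X t).Nonempty →
    ∀ p ∈ localSimplex (b t), minCost F (b t) (v t) p ≤ minCost F (b t) (v t) (w t)
  tracking : ∀ t, K < t → ∀ i,
    (∑ s ∈ Finset.Icc 1 t, w s i) - (pulls I i t : ℝ) ≤
      (∑ s ∈ Finset.Icc 1 t, w s (I t)) - (pulls I (I t) t : ℝ)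

/-- The bandit interaction on the instance with means `μ`: the arm of round `t + 1` is chosen from
the information available after round `t`, and, given this information, the observation of round
`t + 1` is distributed according to the chosen arm. -/
structure IsBanditProcess {K : ℕ} {Ω : Type*} {mΩ : MeasurableSpace Ω} (F : ExpFamily)
    (μ : Fin K → ℝ) (P : Measure Ω) (ℱ : Filtration ℕ mΩ) (I : ℕ → Ω → Fin K) (X : ℕ → Ω → ℝ) :
    Prop where
  arm_measurable : ∀ t, Measurable[ℱ t] (I (t + 1))
  obs_measurable : ∀ t, Measurable[ℱ (t + 1)] (X (t + 1))
  cond_law : ∀ t, ∀ B : Set ℝ, MeasurableSet B →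
    P⟦X (t + 1) ⁻¹' B | ℱ t⟧ =ᵐ[P] fun ω => (F.law (μ (I (t + 1) ω))).real B

/-! Optimism plus a potential argument. While `μ` is in the confidence region, the value of the
optimistic game is at least c = `invCharTime F star μ`, which is positive (`invCharTime_pos`). If
the optimistic best arm is wrong, the weights at v(t) must distinguish it from `μ`, and bounded
natural parameters make that value at most M Σ_a w_a |v_a − μ_a| (`minCost_le_sum_abs`). Both
vectors lie in the region and tracking keeps pulls comparable to the cumulated weights W_a, so |v_a
− μ_a| = O(√(r(t)/W_a)). Since Σ_s w_a(s)/√W_a(s) ≤ 2√t (`sum_div_sqrt_sum_le`), the number of wrong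
rounds is O(√(r t)) = o(t) up to the running maximum of r (`card_wrong_le`).

Right rounds each give the best arm and its neighbours a weight bounded below (`mul_card_right_le`).
Those arms are therefore sampled linearly often and v(t) is close to `μ` on them, whereas a unimodal
vector peaking elsewhere would have a neighbour of `star` at least as high as `star`. Hence b(t) =
`star` (`exists_optimistic_arm_eq`). This needs the region to contain `μ` only on the last three
quarters of the rounds: in (i) these rounds exceed √t, whence f(t) ≤ f(s²) ≤ r(s); in (ii)
concentration at each late s suffices. Weights then vanish elsewhere, and tracking stops those
pulls. -/

namespace ExpFamily

/-! ### Divergence bounds in the exponential family -/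

variable {F : ExpFamily} {m m' : ℝ}

theorem kl_nonneg (F : ExpFamily) (m m' : ℝ) : 0 ≤ F.kl m m' := ENNReal.toReal_nonneg

theorem kl_eq (hm : m ∈ F.means) (hm' : m' ∈ F.means) :
    F.kl m m' = (F.natParam m - F.natParam m') * m
      - (cgf id F.base (F.natParam m) - cgf id F.base (F.natParam m')) := by
  have h := (klDiv_tilted F.base F.base_ne_zero (F.natParam_mem m hm) (F.natParam_mem m' hm')).2
  rwa [F.mean_eq m hm] at h

theorem kl_add_kl (hm : m ∈ F.means) (hm' : m' ∈ F.means) :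
    F.kl m m' + F.kl m' m = (F.natParam m - F.natParam m') * (m - m') := by
  rw [kl_eq hm hm', kl_eq hm' hm]
  ring

/-- The symmetrised divergence is (θ − θ')(m − m'), and its other half is nonnegative. -/
theorem kl_le_mul_abs {M : ℝ} (hM : ∀ m ∈ F.means, ∀ m' ∈ F.means,
    |F.natParam m - F.natParam m'| ≤ M) (hm : m ∈ F.means) (hm' : m' ∈ F.means) :
    F.kl m m' ≤ M * |m - m'| := by
  have h1 := kl_add_kl hm hm'
  have h2 := F.kl_nonneg m' m
  calc F.kl m m' ≤ (F.natParam m - F.natParam m') * (m - m') := by linarith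
    _ ≤ |(F.natParam m - F.natParam m') * (m - m')| := le_abs_self _
    _ = |F.natParam m - F.natParam m'| * |m - m'| := abs_mul _ _
    _ ≤ M * |m - m'| := by gcongr; exact hM m hm m' hm'

/-- A quadratic lower bound and a linear upper bound on the same divergence force the means to be
bounded. -/
theorem abs_sub_le_of_subgaussian {M σ : ℝ} (hσ : 0 < σ)
    (hM : ∀ m ∈ F.means, ∀ m' ∈ F.means, |F.natParam m - F.natParam m'| ≤ M)
    (hsub : ∀ m ∈ F.means, ∀ m' ∈ F.means, (m' - m) ^ 2 / (2 * σ ^ 2) ≤ F.kl m m')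
    (hm : m ∈ F.means) (hm' : m' ∈ F.means) : |m - m'| ≤ 2 * σ ^ 2 * M := by
  have h := (hsub m hm m' hm').trans (kl_le_mul_abs hM hm hm')
  rw [div_le_iff₀ (by positivity), ← sq_abs, abs_sub_comm m' m] at h
  have hM0 : 0 ≤ M := (abs_nonneg _).trans (hM m hm m hm)
  rcases (abs_nonneg (m - m')).eq_or_lt with h0 | h0
  · rw [← h0]; positivity
  · nlinarith

theorem monotoneOn_natParam (F : ExpFamily) {σ : ℝ} (hσ : 0 < σ)
    (hsub : ∀ m ∈ F.means, ∀ m' ∈ F.means, (m' - m) ^ 2 / (2 * σ ^ 2) ≤ F.kl m m') :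
    MonotoneOn F.natParam F.means := by
  intro m hm m' hm' hle
  rcases hle.eq_or_lt with rfl | hlt
  · exact le_rfl
  have h1 := kl_add_kl hm hm'
  have h2 := hsub m hm m' hm'
  have h3 := F.kl_nonneg m' m
  have h4 : 0 < (m' - m) ^ 2 / (2 * σ ^ 2) := by
    have := sub_pos.2 hlt
    positivity
  nlinarith

/-- The member of mean p is one competitor in the supremum; its log-likelihood ratio is affine in x.
-/
theorem ofReal_le_empKL {p : ℝ} (hp : p ∈ F.means) (hm : m ∈ F.means) (x : ℝ) :
    ENNReal.ofReal (F.kl p m + (F.natParam p - F.natParam m) * (x - p)) ≤ F.empKL x m := by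
  refine le_iSup₂_of_le (F.natParam p) (F.natParam_mem p hp) (ENNReal.ofReal_le_ofReal ?_)
  rw [kl_eq hp hm]
  exact le_of_eq (by ring)

/-- Two members whose divergences from the same empirical mean are small have close means. -/
theorem mul_sq_sub_le {σ R x : ℝ} {N : ℕ} (hσ : 0 < σ)
    (hsub : ∀ m ∈ F.means, ∀ m' ∈ F.means, (m' - m) ^ 2 / (2 * σ ^ 2) ≤ F.kl m m')
    (hR : 0 ≤ R) (hm : m ∈ F.means) (hm' : m' ∈ F.means)
    (h : (N : ENNReal) * F.empKL x m ≤ ENNReal.ofReal R)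
    (h' : (N : ENNReal) * F.empKL x m' ≤ ENNReal.ofReal R) :
    N * (m - m') ^ 2 ≤ 8 * σ ^ 2 * R := by
  wlog hle : m ≤ m' generalizing m m'
  · rw [← neg_sub m' m, neg_sq]
    exact this hm' hm h' h (le_of_not_ge hle)
  -- The midpoint is the competitor. For the endpoint q separated from x by p, the affine term is
  -- nonnegative, leaving d(p, q) ≥ (m − m')²/(8σ²); x need not be a mean of the family.
  set p := (m + m') / 2 with hp
  have hpm : p ∈ F.means :=
    F.means_ordConnected.out hm hm' ⟨by rw [hp]; linarith, by rw [hp]; linarith⟩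
  have hmono := F.monotoneOn_natParam hσ hsub
  have hθ := hmono hm hpm (by rw [hp]; linarith)
  have hθ' := hmono hpm hm' (by rw [hp]; linarith)
  have key : ∀ q ∈ F.means, (q - p) ^ 2 = (m - m') ^ 2 / 4 →
      0 ≤ (F.natParam p - F.natParam q) * (x - p) →
      (N : ENNReal) * F.empKL x q ≤ ENNReal.ofReal R → N * (m - m') ^ 2 ≤ 8 * σ ^ 2 * R := by
    intro q hq hqp hpos hqR
    have h1 : ENNReal.ofReal ((q - p) ^ 2 / (2 * σ ^ 2)) ≤ F.empKL x q :=
      (ENNReal.ofReal_le_ofReal (by linarith [hsub p hpm q hq])).trans (ofReal_le_empKL hpm hq x)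
    have h2 : (N : ENNReal) * ENNReal.ofReal ((q - p) ^ 2 / (2 * σ ^ 2)) ≤ ENNReal.ofReal R :=
      (mul_le_mul_right h1 _).trans hqR
    rw [← ENNReal.ofReal_natCast, ← ENNReal.ofReal_mul (by positivity),
      ENNReal.ofReal_le_ofReal_iff hR, hqp] at h2
    have h3 : (N : ℝ) * (m - m') ^ 2
        = 8 * σ ^ 2 * (N * ((m - m') ^ 2 / 4 / (2 * σ ^ 2))) := by field_simp; ring
    rw [h3]
    gcongr
  rcases le_total p x with hx | hx
  · exact key m hm (by rw [hp]; ring)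
      (mul_nonneg (sub_nonneg.2 hθ) (sub_nonneg.2 hx)) h
  · exact key m' hm' (by rw [hp]; ring)
      (mul_nonneg_of_nonpos_of_nonpos (sub_nonpos.2 hθ') (sub_nonpos.2 hx)) h'

end ExpFamily

/-! ### Pull counts and tracking -/

section Pulls

variable {K : ℕ} (I : ℕ → Fin K)

theorem pulls_succ (a : Fin K) {t : ℕ} (ht : 1 ≤ t) :
    pulls I a (t + 1) = pulls I a t + if I t = a then 1 else 0 := by
  unfold pulls
  rw [← Finset.insert_Ico_right_eq_Ico_add_one ht, Finset.filter_insert]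
  split_ifs with h
  · rw [Finset.card_insert_of_notMem (by simp)]
  · rfl

theorem pulls_mono (a : Fin K) : Monotone (pulls I a) := fun _ _ h =>
  Finset.card_le_card (Finset.filter_subset_filter _ (Finset.Ico_subset_Ico_right h))

theorem sum_pulls (t : ℕ) : ∑ a, pulls I a t = t - 1 := by
  have := Finset.card_eq_sum_card_fiberwise (f := I) (s := Finset.Ico 1 t)
    (t := Finset.univ) (fun _ _ => Finset.mem_coe.2 (Finset.mem_univ _))
  rw [Nat.card_Ico] at this
  exact this.symm

end Pulls

namespace IsOTaSRun

variable {K : ℕ} {F : ExpFamily} {r : ℕ → ℝ} {I : ℕ → Fin K} {X : ℕ → ℝ}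
  {w v : ℕ → Fin K → ℝ} {b : ℕ → Fin K}

theorem weight_nonneg (h : IsOTaSRun F r I X w v b) {t : ℕ} (ht : 1 ≤ t) (a : Fin K) :
    0 ≤ w t a := (h.simplex t ht).1 a

theorem weight_le_one (h : IsOTaSRun F r I X w v b) {t : ℕ} (ht : 1 ≤ t) (a : Fin K) :
    w t a ≤ 1 := by
  rw [← (h.simplex t ht).2]
  exact Finset.single_le_sum (fun i _ => h.weight_nonneg ht i) (Finset.mem_univ a)

theorem sum_weights_nonneg (h : IsOTaSRun F r I X w v b) (t : ℕ) (a : Fin K) :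
    0 ≤ ∑ s ∈ Finset.Icc 1 t, w s a :=
  Finset.sum_nonneg fun _ hs => h.weight_nonneg (Finset.mem_Icc.1 hs).1 a

theorem sum_weights_le (h : IsOTaSRun F r I X w v b) (t : ℕ) (a : Fin K) :
    ∑ s ∈ Finset.Icc 1 t, w s a ≤ t := by
  calc ∑ s ∈ Finset.Icc 1 t, w s a ≤ ∑ s ∈ Finset.Icc 1 t, (1 : ℝ) :=
        Finset.sum_le_sum fun _ hs => h.weight_le_one (Finset.mem_Icc.1 hs).1 a
    _ = t := by simp

/-- Weights include round t while pulls stop before it; the surplus of one makes some deficit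
positive. -/
theorem sum_deficits (h : IsOTaSRun F r I X w v b) {t : ℕ} (ht : 1 ≤ t) :
    ∑ a, (∑ s ∈ Finset.Icc 1 t, w s a - (pulls I a t : ℝ)) = 1 := by
  rw [Finset.sum_sub_distrib, Finset.sum_comm,
    Finset.sum_congr rfl fun s hs => (h.simplex s (Finset.mem_Icc.1 hs).1).2, ← Nat.cast_sum,
    sum_pulls, Nat.cast_sub ht]
  simp

/-- The arm pulled by the tracking rule is late with respect to its cumulated weight. -/
theorem pulls_lt_sum_weights (h : IsOTaSRun F r I X w v b) {t : ℕ} (ht : K < t) :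
    (pulls I (I t) t : ℝ) < ∑ s ∈ Finset.Icc 1 t, w s (I t) := by
  by_contra! hcon
  have h1 := h.sum_deficits (t := t) (by omega)
  have h2 : ∑ a, (∑ s ∈ Finset.Icc 1 t, w s a - (pulls I a t : ℝ)) ≤ 0 :=
    Finset.sum_nonpos fun a _ => (h.tracking t ht a).trans (by linarith)
  linarith

theorem pulls_le_one (h : IsOTaSRun F r I X w v b) {t : ℕ} (ht : t ≤ K + 1) (a : Fin K) :
    pulls I a t ≤ 1 := by
  refine Finset.card_le_one.2 fun s hs s' hs' => ?_
  simp only [Finset.mem_filter, Finset.mem_Ico] at hs hs'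
  exact h.init.injOn ⟨hs.1.1, by omega⟩ ⟨hs'.1.1, by omega⟩ (hs.2.trans hs'.2.symm)

theorem one_le_pulls (h : IsOTaSRun F r I X w v b) {t : ℕ} (ht : K < t) (a : Fin K) :
    1 ≤ pulls I a t := by
  obtain ⟨s, hs, hsa⟩ := h.init.surjOn (Set.mem_univ a)
  refine Finset.card_pos.2 ⟨s, ?_⟩
  simp only [Finset.mem_filter, Finset.mem_Ico]
  exact ⟨⟨hs.1, hs.2.trans_lt ht⟩, hsa⟩

/-- Initialisation costs at most one pull; afterwards only an arm behind its cumulated weight is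
pulled. -/
theorem pulls_le_sum_weights_add_one (h : IsOTaSRun F r I X w v b) (t : ℕ) (a : Fin K) :
    (pulls I a t : ℝ) ≤ ∑ s ∈ Finset.Icc 1 t, w s a + 1 := by
  induction t with
  | zero => simp [pulls]
  | succ t ih =>
    rcases le_or_gt t K with htK | htK
    · have h1 : (pulls I a (t + 1) : ℝ) ≤ 1 := by
        exact_mod_cast h.pulls_le_one (by omega) a
      linarith [h.sum_weights_nonneg (t + 1) a]
    · rw [pulls_succ I a (by omega), Finset.sum_Icc_succ_top (by omega)]
      have hw := h.weight_nonneg (t := t + 1) (by omega) a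
      split_ifs with hI
      · have := h.pulls_lt_sum_weights htK
        rw [hI] at this
        push_cast
        linarith
      · push_cast
        linarith

/-- The deficits sum to 1 and the K − 1 others are at least −1. -/
theorem sum_weights_le_pulls_add (h : IsOTaSRun F r I X w v b) {t : ℕ} (ht : 1 ≤ t)
    (a : Fin K) : ∑ s ∈ Finset.Icc 1 t, w s a ≤ pulls I a t + K := by
  have h1 := h.sum_deficits ht
  rw [← Finset.add_sum_erase _ _ (Finset.mem_univ a)] at h1
  have h2 : ∑ i ∈ Finset.univ.erase a, (-1 : ℝ) ≤ ∑ i ∈ Finset.univ.erase a,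
      (∑ s ∈ Finset.Icc 1 t, w s i - (pulls I i t : ℝ)) :=
    Finset.sum_le_sum fun i _ => by linarith [h.pulls_le_sum_weights_add_one t i]
  have hK : 1 ≤ K := a.pos
  rw [Finset.sum_const, Finset.card_erase_of_mem (Finset.mem_univ a), Finset.card_univ,
    Fintype.card_fin, nsmul_eq_mul, Nat.cast_sub hK] at h2
  push_cast at h2
  linarith

theorem sum_weights_le_mul_pulls (h : IsOTaSRun F r I X w v b) {t : ℕ} (ht : K < t)
    (a : Fin K) : ∑ s ∈ Finset.Icc 1 t, w s a ≤ (K + 1) * pulls I a t := by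
  have h1 := h.sum_weights_le_pulls_add (t := t) (by omega) a
  have h2 : (1 : ℝ) ≤ pulls I a t := by exact_mod_cast h.one_le_pulls ht a
  nlinarith [(Nat.cast_nonneg K : (0 : ℝ) ≤ K)]

end IsOTaSRun

/-- Discrete form of ∫ dx/√x = 2√x: each term is at most a telescoping difference 2(√B − √A), and 0
when B = 0. -/
theorem sum_div_sqrt_sum_le {x : ℕ → ℝ} (hx : ∀ s, 1 ≤ s → 0 ≤ x s) (t : ℕ) :
    ∑ s ∈ Finset.Icc 1 t, x s / √(∑ u ∈ Finset.Icc 1 s, x u)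
      ≤ 2 * √(∑ u ∈ Finset.Icc 1 t, x u) := by
  induction t with
  | zero => simp
  | succ t ih =>
    rw [Finset.sum_Icc_succ_top (by omega)]
    have hA : 0 ≤ ∑ u ∈ Finset.Icc 1 t, x u :=
      Finset.sum_nonneg fun s hs => hx s (Finset.mem_Icc.1 hs).1
    have hB : ∑ u ∈ Finset.Icc 1 (t + 1), x u = ∑ u ∈ Finset.Icc 1 t, x u + x (t + 1) :=
      Finset.sum_Icc_succ_top (by omega) _
    have h0 := hx (t + 1) (by omega)
    set A := ∑ u ∈ Finset.Icc 1 t, x u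
    set B := ∑ u ∈ Finset.Icc 1 (t + 1), x u
    have hle : √A ≤ √B := Real.sqrt_le_sqrt (by linarith)
    have hstep : x (t + 1) / √B ≤ 2 * (√B - √A) := by
      rcases (Real.sqrt_nonneg B).eq_or_lt with hz | hz
      · rw [← hz] at hle ⊢
        simp [le_antisymm hle (Real.sqrt_nonneg A)]
      · rw [div_le_iff₀ hz]
        have e1 := Real.sq_sqrt hA
        have e2 := Real.sq_sqrt (show 0 ≤ B by linarith)
        nlinarith [Real.sqrt_nonneg A]
    linarith

/-! ### Unimodal vectors -/

section Unimodal

variable {K : ℕ}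

theorem neighbors_nonempty (hK : 2 ≤ K) (i : Fin K) : (neighbors i).Nonempty := by
  rcases Nat.eq_zero_or_pos i.val with h | h
  · exact ⟨⟨1, by omega⟩, Or.inr (by simp [h])⟩
  · exact ⟨⟨i.val - 1, by omega⟩, Or.inl (by simp only; omega)⟩

theorem ne_of_mem_neighbors {i j : Fin K} (h : j ∈ neighbors i) : j ≠ i := by
  rintro rfl
  rcases h with h | h <;> omega

/-- Outside of its best arm, a unimodal vector does not decrease towards the best arm. -/
theorem UnimodalAt.exists_neighbor_le {v : Fin K → ℝ} {b a : Fin K} (h : UnimodalAt v b)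
    (hab : a ≠ b) : ∃ i ∈ neighbors a, v a ≤ v i := by
  rcases lt_or_gt_of_ne hab with hlt | hlt
  · have hlt' : a.val < b.val := hlt
    refine ⟨⟨a.val + 1, by omega⟩, Or.inr rfl, h.2.1 hlt.le ?_ ?_⟩ <;>
      simp only [Set.mem_Iic, Fin.le_def] <;> omega
  · have hlt' : b.val < a.val := hlt
    refine ⟨⟨a.val - 1, by omega⟩, Or.inl (by simp only; omega), h.2.2 ?_ hlt.le ?_⟩ <;>
      simp only [Set.mem_Ici, Fin.le_def] <;> omega

theorem UnimodalAt.exists_gap {v : Fin K → ℝ} {b : Fin K} (h : UnimodalAt v b) :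
    ∃ δ > 0, ∀ j, j ≠ b → v j + δ ≤ v b := by
  by_cases hne : (Finset.univ.erase b).Nonempty
  · obtain ⟨i, hi, hmin⟩ := Finset.exists_min_image (Finset.univ.erase b) (fun j => v b - v j) hne
    refine ⟨v b - v i, sub_pos.2 (h.1 i (Finset.ne_of_mem_erase hi)), fun j hj => ?_⟩
    have := hmin j (Finset.mem_erase.2 ⟨hj, Finset.mem_univ j⟩)
    linarith
  · exact ⟨1, one_pos, fun j hj => absurd ⟨j, Finset.mem_erase.2 ⟨hj, Finset.mem_univ j⟩⟩ hne⟩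

end Unimodal

/-! ### Bounds on the transportation costs -/

section Costs

variable {K : ℕ} {F : ExpFamily} {b : Fin K} {v w : Fin K → ℝ}

theorem bddBelow_transport (hw : ∀ a, 0 ≤ w a) (i : Fin K) :
    BddBelow ((fun x => w b * F.kl (v b) x + w i * F.kl (v i) x) '' Set.Ioo (v i) (v b)) := by
  refine ⟨0, ?_⟩
  rintro _ ⟨x, -, rfl⟩
  exact add_nonneg (mul_nonneg (hw b) (F.kl_nonneg _ _)) (mul_nonneg (hw i) (F.kl_nonneg _ _))

theorem transportCost_nonneg (hw : ∀ a, 0 ≤ w a) (i : Fin K) : 0 ≤ transportCost F b v w i := by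
  apply Real.sInf_nonneg
  rintro _ ⟨x, -, rfl⟩
  exact add_nonneg (mul_nonneg (hw b) (F.kl_nonneg _ _)) (mul_nonneg (hw i) (F.kl_nonneg _ _))

theorem minCost_le_transportCost (hw : ∀ a, 0 ≤ w a) {i : Fin K} (hi : i ∈ neighbors b) :
    minCost F b v w ≤ transportCost F b v w i := by
  refine csInf_le ⟨0, ?_⟩ ⟨i, hi, rfl⟩
  rintro _ ⟨j, -, rfl⟩
  exact transportCost_nonneg hw j

variable {M : ℝ} (hM : ∀ m ∈ F.means, ∀ m' ∈ F.means, |F.natParam m - F.natParam m'| ≤ M)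
  (hv : ∀ a, v a ∈ F.means) (hb : UnimodalAt v b)

include hM hv hb in
-- The linear majorant is continuous, so it passes from the open interval of the infimum to the
-- endpoints.
theorem minCost_le_of_mem_Icc (hw : ∀ a, 0 ≤ w a) {i : Fin K} (hi : i ∈ neighbors b) {x : ℝ}
    (hx : x ∈ Set.Icc (v i) (v b)) :
    minCost F b v w ≤ M * (w b * (v b - x) + w i * (x - v i)) := by
  have hlt : v i < v b := hb.1 i (ne_of_mem_neighbors hi)
  rw [← closure_Ioo hlt.ne] at hx
  refine le_on_closure (f := fun _ => minCost F b v w)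
    (g := fun x => M * (w b * (v b - x) + w i * (x - v i))) ?_ (by fun_prop) (by fun_prop) hx
  intro y hy
  have hym : y ∈ F.means := F.means_ordConnected.out (hv i) (hv b) (Set.Ioo_subset_Icc_self hy)
  have h1 := ExpFamily.kl_le_mul_abs hM (hv b) hym
  have h2 := ExpFamily.kl_le_mul_abs hM (hv i) hym
  rw [abs_of_pos (sub_pos.2 hy.2)] at h1
  rw [abs_sub_comm, abs_of_pos (sub_pos.2 hy.1)] at h2
  calc minCost F b v w ≤ transportCost F b v w i := minCost_le_transportCost hw hi
    _ ≤ w b * F.kl (v b) y + w i * F.kl (v i) y :=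
        csInf_le (bddBelow_transport hw i) ⟨y, hy, rfl⟩
    _ ≤ w b * (M * (v b - y)) + w i * (M * (y - v i)) :=
        add_le_add (mul_le_mul_of_nonneg_left h1 (hw b)) (mul_le_mul_of_nonneg_left h2 (hw i))
    _ = M * (w b * (v b - y) + w i * (y - v i)) := by ring

include hM hv hb in
/-- If another unimodal vector `u` has a different best arm, then the weights cannot distinguish
`v` from `u` better than through the distances of their coordinates. -/
theorem minCost_le_sum_abs (hM0 : 0 ≤ M) (hw : ∀ a, 0 ≤ w a) {u : Fin K → ℝ} {c : Fin K}
    (hu : UnimodalAt u c) (hbc : b ≠ c) :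
    minCost F b v w ≤ M * ∑ a, w a * |v a - u a| := by
  obtain ⟨i, hi, hui⟩ := hu.exists_neighbor_le hbc
  have hib := ne_of_mem_neighbors hi
  have hlt : v i < v b := hb.1 i hib
  -- The witness is u b clipped to [v i, v b]; the second bound uses u b ≤ u i.
  have hx : ∃ x ∈ Set.Icc (v i) (v b), v b - x ≤ |v b - u b| ∧ x - v i ≤ |v i - u i| := by
    rcases le_total (v b) (u b) with h1 | h1
    · refine ⟨v b, ⟨hlt.le, le_rfl⟩, by simp, ?_⟩
      rw [abs_sub_comm]
      exact le_trans (by linarith) (le_abs_self _)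
    rcases le_total (u b) (v i) with h2 | h2
    · exact ⟨v i, ⟨le_rfl, hlt.le⟩, le_trans (by linarith) (le_abs_self _), by simp⟩
    · refine ⟨u b, ⟨h2, h1⟩, le_abs_self _, ?_⟩
      rw [abs_sub_comm]
      exact le_trans (by linarith) (le_abs_self _)
  obtain ⟨x, hxI, hxb, hxi⟩ := hx
  refine (minCost_le_of_mem_Icc hM hv hb hw hi hxI).trans (mul_le_mul_of_nonneg_left ?_ hM0)
  calc w b * (v b - x) + w i * (x - v i) ≤ w b * |v b - u b| + w i * |v i - u i| :=
        add_le_add (mul_le_mul_of_nonneg_left hxb (hw b)) (mul_le_mul_of_nonneg_left hxi (hw i))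
    _ = ∑ a ∈ {b, i}, w a * |v a - u a| :=
        (Finset.sum_pair (f := fun a => w a * |v a - u a|) hib.symm).symm
    _ ≤ ∑ a, w a * |v a - u a| :=
        Finset.sum_le_sum_of_subset_of_nonneg (Finset.subset_univ _)
          fun a _ _ => mul_nonneg (hw a) (abs_nonneg _)

include hM hv hb in
-- At an endpoint of the interval only one of the two arms pays. Read backwards, a large value
-- forces weight on every relevant arm.
theorem minCost_le_mul_weight (hK : 2 ≤ K) (hM0 : 0 ≤ M) {D : ℝ}
    (hD : ∀ m ∈ F.means, ∀ m' ∈ F.means, |m - m'| ≤ D) (hw : ∀ a, 0 ≤ w a) {a : Fin K}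
    (ha : a = b ∨ a ∈ neighbors b) : minCost F b v w ≤ M * D * w a := by
  have key : ∀ i ∈ neighbors b, ∀ y, 0 ≤ y → M * (y * (v b - v i)) ≤ M * D * y := by
    intro i _ y hy
    rw [mul_assoc, mul_comm D]
    gcongr
    exact (le_abs_self _).trans (hD _ (hv b) _ (hv i))
  rcases ha with rfl | ha
  · obtain ⟨i, hi⟩ := neighbors_nonempty hK a
    have hlt := hb.1 i (ne_of_mem_neighbors hi)
    have := minCost_le_of_mem_Icc hM hv hb hw hi ⟨le_rfl, hlt.le⟩
    rw [sub_self, mul_zero, add_zero] at this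
    exact this.trans (key i hi _ (hw _))
  · have hlt := hb.1 a (ne_of_mem_neighbors ha)
    have := minCost_le_of_mem_Icc hM hv hb hw ha ⟨hlt.le, le_rfl⟩
    rw [sub_self, mul_zero, zero_add] at this
    exact this.trans (key a ha _ (hw _))

theorem invCharTime_le_minCost (hw : w ∈ localSimplex b)
    (h : ∀ p ∈ localSimplex b, minCost F b v p ≤ minCost F b v w) :
    invCharTime F b v ≤ minCost F b v w := by
  refine csSup_le ⟨_, w, hw, rfl⟩ ?_
  rintro _ ⟨p, hp, rfl⟩
  exact h p hp

include hM hv hb in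
-- Bounded means make the real supremum genuine instead of its default value 0.
theorem minCost_le_invCharTime (hK : 2 ≤ K) (hM0 : 0 ≤ M) {D : ℝ} (hD0 : 0 ≤ D)
    (hD : ∀ m ∈ F.means, ∀ m' ∈ F.means, |m - m'| ≤ D) (hw : w ∈ localSimplex b) :
    minCost F b v w ≤ invCharTime F b v := by
  refine le_csSup ⟨M * D, ?_⟩ ⟨w, hw, rfl⟩
  rintro _ ⟨p, hp, rfl⟩
  refine (minCost_le_mul_weight hM hv hb hK hM0 hD hp.1.1 (Or.inl rfl)).trans ?_
  have h1 : p b ≤ 1 := by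
    rw [← hp.1.2]
    exact Finset.single_le_sum (fun i _ => hp.1.1 i) (Finset.mem_univ b)
  exact mul_le_of_le_one_right (mul_nonneg hM0 hD0) h1

theorem exists_localSimplex_pos (b : Fin K) :
    ∃ p ∈ localSimplex b, ∃ η > 0, ∀ a, a = b ∨ a ∈ neighbors b → η ≤ p a := by
  classical
  set S : Finset (Fin K) := Finset.univ.filter fun a => a = b ∨ a ∈ neighbors b with hS
  have hbS : b ∈ S := by simp [hS]
  have hpos : (0 : ℝ) < S.card := by exact_mod_cast Finset.card_pos.2 ⟨b, hbS⟩
  refine ⟨fun a => if a ∈ S then (S.card : ℝ)⁻¹ else 0, ⟨⟨fun a => ?_, ?_⟩, fun a h1 h2 => ?_⟩,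
    (S.card : ℝ)⁻¹, by positivity, fun a ha => ?_⟩
  · simp only
    split_ifs <;> positivity
  · rw [Finset.sum_ite_mem, Finset.univ_inter, Finset.sum_const, nsmul_eq_mul,
      mul_inv_cancel₀ hpos.ne']
  · exact if_neg (by simp [hS, h1, h2])
  · have : a ∈ S := by simp [hS, ha]
    simp [this]

include hM hv hb in
theorem invCharTime_pos (hK : 2 ≤ K) (hM0 : 0 ≤ M) {D σ : ℝ} (hσ : 0 < σ) (hD0 : 0 ≤ D)
    (hD : ∀ m ∈ F.means, ∀ m' ∈ F.means, |m - m'| ≤ D)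
    (hsub : ∀ m ∈ F.means, ∀ m' ∈ F.means, (m' - m) ^ 2 / (2 * σ ^ 2) ≤ F.kl m m') :
    0 < invCharTime F b v := by
  obtain ⟨p, hp, η, hη, hpη⟩ := exists_localSimplex_pos b
  obtain ⟨δ, hδ, hgap⟩ := hb.exists_gap
  -- No x is close to both v b and v i: the squared distances sum to at least δ²/2.
  refine lt_of_lt_of_le (b := η * (δ ^ 2 / (4 * σ ^ 2))) (by positivity)
    (le_trans ?_ (minCost_le_invCharTime hM hv hb hK hM0 hD0 hD hp))
  refine le_csInf ((neighbors_nonempty hK b).image _) ?_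
  rintro _ ⟨i, hi, rfl⟩
  have hib := ne_of_mem_neighbors hi
  refine le_csInf ((Set.nonempty_Ioo.2 (hb.1 i hib)).image _) ?_
  rintro _ ⟨x, hx, rfl⟩
  have hxm : x ∈ F.means := F.means_ordConnected.out (hv i) (hv b) (Set.Ioo_subset_Icc_self hx)
  have hg := hgap i hib
  calc η * (δ ^ 2 / (4 * σ ^ 2))
      ≤ η * ((x - v b) ^ 2 / (2 * σ ^ 2) + (x - v i) ^ 2 / (2 * σ ^ 2)) := by
        gcongr
        rw [← add_div, div_le_div_iff₀ (by positivity) (by positivity)]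
        have : δ ^ 2 ≤ 2 * ((x - v b) ^ 2 + (x - v i) ^ 2) := by
          nlinarith [sq_nonneg (x - v b + (x - v i))]
        nlinarith [sq_pos_of_pos hσ]
    _ = η * ((x - v b) ^ 2 / (2 * σ ^ 2)) + η * ((x - v i) ^ 2 / (2 * σ ^ 2)) := mul_add _ _ _
    _ ≤ p b * F.kl (v b) x + p i * F.kl (v i) x := by
        have h1 := hpη b (Or.inl rfl)
        have h2 := hpη i (Or.inr hi)
        have h3 := hsub _ (hv b) x hxm
        have h4 := hsub _ (hv i) x hxm
        have h5 := hp.1.1 b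
        have h6 := hp.1.1 i
        gcongr

end Costs

/-- Since r need not be monotone, its finitely many early values are absorbed by taking t large. -/
theorem Asymptotics.IsLittleO.exists_forall_le_mul {r : ℕ → ℝ}
    (hr : r =o[atTop] fun n : ℕ => (n : ℝ)) {ε : ℝ} (hε : 0 < ε) :
    ∃ T : ℕ, ∀ t ≥ T, ∀ s ≤ t, r s ≤ ε * t := by
  obtain ⟨n₀, hn₀⟩ := eventually_atTop.1 (hr.def hε)
  obtain ⟨n₁, hn₁⟩ := exists_nat_ge ((∑ s ∈ Finset.range n₀, |r s|) / ε)
  refine ⟨n₁, fun t ht s hst => ?_⟩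
  have hst' : (s : ℝ) ≤ t := by exact_mod_cast hst
  have ht' : (n₁ : ℝ) ≤ t := by exact_mod_cast ht
  rcases le_or_gt n₀ s with h | h
  · have := hn₀ s h
    rw [Real.norm_eq_abs, Real.norm_eq_abs, Nat.abs_cast] at this
    exact (le_abs_self _).trans (this.trans (by gcongr))
  · rw [div_le_iff₀ hε] at hn₁
    calc r s ≤ |r s| := le_abs_self _
      _ ≤ ∑ s ∈ Finset.range n₀, |r s| :=
        Finset.single_le_sum (f := fun s => |r s|) (fun _ _ => abs_nonneg _)
          (Finset.mem_range.2 h)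
      _ ≤ ε * t := by nlinarith

/-! ### Counting wrong and right rounds along a run -/

namespace IsOTaSRun

variable {K : ℕ} {F : ExpFamily} {r : ℕ → ℝ} {I : ℕ → Fin K} {X : ℕ → ℝ}
  {w v : ℕ → Fin K → ℝ} {b : ℕ → Fin K}

theorem invCharTime_le_minCost (h : IsOTaSRun F r I X w v b) {t : ℕ} (ht : K < t)
    {u : Fin K → ℝ} {i : Fin K} (hu : u ∈ structuredRegion F r I X t) (hi : UnimodalAt u i) :
    invCharTime F i u ≤ minCost F (b t) (v t) (w t) :=
  (h.optimistic_max t ht u hu i hi).trans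
    (_root_.invCharTime_le_minCost (h.weights_mem t ht ⟨u, hu⟩) (h.weights_max t ht ⟨u, hu⟩))

/-- Two points of one region are close relative to the pulls, and tracking replaces pulls by
cumulated weights. -/
theorem sum_weights_mul_sq_le (h : IsOTaSRun F r I X w v b) {σ R : ℝ} (hσ : 0 < σ)
    (hsub : ∀ m ∈ F.means, ∀ m' ∈ F.means, (m' - m) ^ 2 / (2 * σ ^ 2) ≤ F.kl m m')
    {t : ℕ} (ht : K < t) (hR : 0 ≤ R) (hrR : r t ≤ R) {u : Fin K → ℝ}
    (hu : u ∈ structuredRegion F r I X t) (a : Fin K) :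
    (∑ s ∈ Finset.Icc 1 t, w s a) * (v t a - u a) ^ 2 ≤ (K + 1) * (8 * σ ^ 2 * R) := by
  have hv := (h.optimistic_mem t ht ⟨u, hu⟩).1
  have hle := ENNReal.ofReal_le_ofReal hrR
  have h1 := ExpFamily.mul_sq_sub_le hσ hsub hR (hv.1 a).1 (hu.1 a).1
    ((hv.1 a).2.trans hle) ((hu.1 a).2.trans hle)
  calc (∑ s ∈ Finset.Icc 1 t, w s a) * (v t a - u a) ^ 2
      ≤ ((K + 1) * pulls I a t) * (v t a - u a) ^ 2 := by
        gcongr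
        exact h.sum_weights_le_mul_pulls ht a
    _ = (K + 1) * (pulls I a t * (v t a - u a) ^ 2) := mul_assoc _ _ _
    _ ≤ (K + 1) * (8 * σ ^ 2 * R) := by gcongr

theorem weight_mul_abs_le (h : IsOTaSRun F r I X w v b) {t : ℕ} (ht : 1 ≤ t) {a : Fin K}
    {x A : ℝ} (hx : (∑ s ∈ Finset.Icc 1 t, w s a) * x ^ 2 ≤ A) :
    w t a * |x| ≤ √A * (w t a / √(∑ s ∈ Finset.Icc 1 t, w s a)) := by
  have hwW : w t a ≤ ∑ s ∈ Finset.Icc 1 t, w s a :=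
    Finset.single_le_sum (f := fun s => w s a)
      (fun s hs => h.weight_nonneg (Finset.mem_Icc.1 hs).1 a) (Finset.mem_Icc.2 ⟨ht, le_rfl⟩)
  have hw := h.weight_nonneg ht a
  set W := ∑ s ∈ Finset.Icc 1 t, w s a
  rcases (hw.trans hwW).eq_or_lt with h0 | h0
  · have : w t a = 0 := le_antisymm (h0 ▸ hwW) hw
    simp [this]
  · have h1 : √W * |x| ≤ √A := by
      rw [← Real.sqrt_sq_eq_abs, ← Real.sqrt_mul h0.le]
      exact Real.sqrt_le_sqrt hx
    have h2 := Real.sqrt_pos.2 h0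
    rw [mul_div_assoc', le_div_iff₀ h2]
    nlinarith

/-- If the true instance belongs to the confidence regions of the rounds from `m` to `t`, then the
rounds in which the optimistic best arm is wrong have a small number. -/
theorem card_wrong_le (h : IsOTaSRun F r I X w v b) {μ : Fin K → ℝ} {star : Fin K}
    (hstar : UnimodalAt μ star) {M σ c q R : ℝ} (hM0 : 0 ≤ M)
    (hM : ∀ m ∈ F.means, ∀ m' ∈ F.means, |F.natParam m - F.natParam m'| ≤ M) (hσ : 0 < σ)
    (hsub : ∀ m ∈ F.means, ∀ m' ∈ F.means, (m' - m) ^ 2 / (2 * σ ^ 2) ≤ F.kl m m')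
    (hc : c ≤ invCharTime F star μ) (hq : 0 ≤ q) (hR : 0 ≤ R) {m t : ℕ} (hKm : K < m)
    (hRq : (K + 1) * (8 * σ ^ 2 * R) ≤ q ^ 2 * t)
    (hrR : ∀ s ∈ Finset.Icc m t, r s ≤ R)
    (hμ : ∀ s ∈ Finset.Icc m t, μ ∈ structuredRegion F r I X s) :
    c * ((Finset.Icc m t).filter fun s => b s ≠ star).card ≤ 2 * M * K * q * t := by
  have hround : ∀ s ∈ (Finset.Icc m t).filter (fun s => b s ≠ star),
      c ≤ ∑ a, M * (q * √t) * (w s a / √(∑ u ∈ Finset.Icc 1 s, w u a)) := by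
    intro s hs
    obtain ⟨hs, hbs⟩ := Finset.mem_filter.1 hs
    have hKs : K < s := hKm.trans_le (Finset.mem_Icc.1 hs).1
    have hμs := hμ s hs
    obtain ⟨hvm, hvu⟩ := h.optimistic_mem s hKs ⟨μ, hμs⟩
    have h1 := minCost_le_sum_abs hM (fun a => (hvm.1 a).1) hvu hM0
      (fun a => h.weight_nonneg (t := s) (by omega) a) hstar hbs
    refine hc.trans ((h.invCharTime_le_minCost hKs hμs hstar).trans (h1.trans ?_))
    rw [Finset.mul_sum]
    refine Finset.sum_le_sum fun a _ => ?_
    rw [mul_assoc M]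
    refine mul_le_mul_of_nonneg_left ?_ hM0
    have h2 := h.weight_mul_abs_le (t := s) (by omega)
      ((h.sum_weights_mul_sq_le hσ hsub hKs hR (hrR s hs) hμs a).trans hRq)
    rwa [Real.sqrt_mul (sq_nonneg q), Real.sqrt_sq hq] at h2
  have hterm : ∀ a, ∀ s ∈ Finset.Icc 1 t,
      0 ≤ M * (q * √t) * (w s a / √(∑ u ∈ Finset.Icc 1 s, w u a)) := fun a s hs =>
    mul_nonneg (by positivity)
      (div_nonneg (h.weight_nonneg (Finset.mem_Icc.1 hs).1 a) (Real.sqrt_nonneg _))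
  calc c * ((Finset.Icc m t).filter fun s => b s ≠ star).card
      = ∑ s ∈ (Finset.Icc m t).filter (fun s => b s ≠ star), c := by
        rw [Finset.sum_const, nsmul_eq_mul, mul_comm]
    _ ≤ ∑ s ∈ (Finset.Icc m t).filter (fun s => b s ≠ star),
          ∑ a, M * (q * √t) * (w s a / √(∑ u ∈ Finset.Icc 1 s, w u a)) :=
        Finset.sum_le_sum hround
    _ ≤ ∑ s ∈ Finset.Icc 1 t,
          ∑ a, M * (q * √t) * (w s a / √(∑ u ∈ Finset.Icc 1 s, w u a)) := by
        -- The sum goes back to round 1 because the telescoping bound involves full cumulated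
        -- weights.
        refine Finset.sum_le_sum_of_subset_of_nonneg ?_
          fun s hs _ => Finset.sum_nonneg fun a _ => hterm a s hs
        exact (Finset.filter_subset _ _).trans (Finset.Icc_subset_Icc (by omega) le_rfl)
    _ = ∑ a, M * (q * √t) * ∑ s ∈ Finset.Icc 1 t, w s a / √(∑ u ∈ Finset.Icc 1 s, w u a) := by
        rw [Finset.sum_comm]
        exact Finset.sum_congr rfl fun a _ => (Finset.mul_sum _ _ _).symm
    _ ≤ ∑ _a : Fin K, M * (q * √t) * (2 * √t) := by
        refine Finset.sum_le_sum fun a _ => mul_le_mul_of_nonneg_left ?_ (by positivity)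
        refine (sum_div_sqrt_sum_le (fun s hs => h.weight_nonneg hs a) t).trans ?_
        gcongr
        exact h.sum_weights_le t a
    _ = 2 * M * K * q * t := by
        rw [Finset.sum_const, Finset.card_univ, Fintype.card_fin, nsmul_eq_mul]
        linear_combination (2 * M * K * q) * Real.mul_self_sqrt (Nat.cast_nonneg (α := ℝ) t)

/-- The best arm and its neighbours have a cumulated weight that is proportional to the number of
rounds in which the optimistic best arm is right. -/
theorem mul_card_right_le (h : IsOTaSRun F r I X w v b) {μ : Fin K → ℝ} {star : Fin K}
    (hK : 2 ≤ K) (hstar : UnimodalAt μ star) {M D c : ℝ} (hM0 : 0 ≤ M)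
    (hM : ∀ m ∈ F.means, ∀ m' ∈ F.means, |F.natParam m - F.natParam m'| ≤ M)
    (hD : ∀ m ∈ F.means, ∀ m' ∈ F.means, |m - m'| ≤ D)
    (hD0 : 0 ≤ D) (hc : c ≤ invCharTime F star μ) {m t : ℕ} (hKm : K < m)
    (hμ : ∀ s ∈ Finset.Icc m t, μ ∈ structuredRegion F r I X s) {a : Fin K}
    (ha : a = star ∨ a ∈ neighbors star) :
    c * ((Finset.Icc m t).filter fun s => b s = star).card
      ≤ M * D * ∑ s ∈ Finset.Icc 1 t, w s a := by
  have hround : ∀ s ∈ (Finset.Icc m t).filter (fun s => b s = star), c ≤ M * D * w s a := by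
    intro s hs
    obtain ⟨hs, hbs⟩ := Finset.mem_filter.1 hs
    have hKs : K < s := hKm.trans_le (Finset.mem_Icc.1 hs).1
    have hμs := hμ s hs
    obtain ⟨hvm, hvu⟩ := h.optimistic_mem s hKs ⟨μ, hμs⟩
    exact hc.trans ((h.invCharTime_le_minCost hKs hμs hstar).trans
      (minCost_le_mul_weight hM (fun a => (hvm.1 a).1) hvu hK hM0 hD
        (fun a => h.weight_nonneg (t := s) (by omega) a) (hbs ▸ ha)))
  calc c * ((Finset.Icc m t).filter fun s => b s = star).card
      = ∑ s ∈ (Finset.Icc m t).filter (fun s => b s = star), c := by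
        rw [Finset.sum_const, nsmul_eq_mul, mul_comm]
    _ ≤ ∑ s ∈ (Finset.Icc m t).filter (fun s => b s = star), M * D * w s a :=
        Finset.sum_le_sum hround
    _ ≤ ∑ s ∈ Finset.Icc 1 t, M * D * w s a := by
        refine Finset.sum_le_sum_of_subset_of_nonneg ?_ fun s hs _ =>
          mul_nonneg (by positivity) (h.weight_nonneg (Finset.mem_Icc.1 hs).1 a)
        exact (Finset.filter_subset _ _).trans (Finset.Icc_subset_Icc (by omega) le_rfl)
    _ = M * D * ∑ s ∈ Finset.Icc 1 t, w s a := (Finset.mul_sum _ _ _).symm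

end IsOTaSRun

/-- After a deterministic round, the optimistic best arm is right, provided that the true instance
was in the confidence region during the last three quarters of the rounds. -/
theorem exists_optimistic_arm_eq {K : ℕ} (F : ExpFamily) (μ : Fin K → ℝ) (star : Fin K)
    (hμ : ∀ i, μ i ∈ F.means) (hstar : UnimodalAt μ star)
    (hbounded : ∃ M : ℝ, ∀ m ∈ F.means, ∀ m' ∈ F.means, |F.natParam m - F.natParam m'| ≤ M)
    (hsubG : ∃ σ : ℝ, 0 < σ ∧
      ∀ m ∈ F.means, ∀ m' ∈ F.means, (m' - m) ^ 2 / (2 * σ ^ 2) ≤ F.kl m m')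
    (r : ℕ → ℝ) (hr : Asymptotics.IsLittleO atTop r (fun n : ℕ => (n : ℝ))) :
    ∃ T₀ : ℕ, ∀ (I : ℕ → Fin K) (X : ℕ → ℝ) (w v : ℕ → Fin K → ℝ) (b : ℕ → Fin K),
      IsOTaSRun F r I X w v b → ∀ t ≥ T₀, ∀ m, K < m → 4 * m ≤ t →
      (∀ s ∈ Finset.Icc m t, μ ∈ structuredRegion F r I X s) → b t = star := by
  rcases lt_or_ge K 2 with hK | hK
  · exact ⟨0, fun _ _ _ _ _ _ _ _ _ _ _ _ => Fin.ext (by omega)⟩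
  obtain ⟨M', hM'⟩ := hbounded
  obtain ⟨σ, hσ, hsub⟩ := hsubG
  obtain ⟨M, hM1, hM⟩ : ∃ M : ℝ, 0 < M ∧
      ∀ m ∈ F.means, ∀ m' ∈ F.means, |F.natParam m - F.natParam m'| ≤ M :=
    ⟨max M' 1, lt_max_of_lt_right one_pos, fun m hm m' hm' =>
      (hM' m hm m' hm').trans (le_max_left _ _)⟩
  have hD : ∀ m ∈ F.means, ∀ m' ∈ F.means, |m - m'| ≤ 2 * σ ^ 2 * M := fun m hm m' hm' =>
    ExpFamily.abs_sub_le_of_subgaussian hσ hM hsub hm hm'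
  have hD0 : 0 < 2 * σ ^ 2 * M := by positivity
  set D := 2 * σ ^ 2 * M
  have hc := invCharTime_pos hM hμ hstar hK hM1.le hσ hD0.le hD hsub
  set c := invCharTime F star μ with hc_def
  obtain ⟨g, hg, hgap⟩ := hstar.exists_gap
  have hK0 : (0 : ℝ) < K := by exact_mod_cast (by omega : 0 < K)
  set δ := c / (M * D) with hδ
  have hδ0 : 0 < δ := by positivity
  -- The first constraint leaves at most t/4 wrong rounds; the second puts v within g/2 of `μ` near
  -- `star`.
  obtain ⟨q, hq, hq1, hq2⟩ : ∃ q : ℝ, 0 < q ∧ 8 * M * K * q ≤ c ∧ 16 * q ^ 2 ≤ g ^ 2 * δ := by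
    refine ⟨min (c / (8 * M * K)) (g * √δ / 4), by positivity, ?_, ?_⟩
    · have := min_le_left (c / (8 * M * K)) (g * √δ / 4)
      rwa [le_div_iff₀ (by positivity), mul_comm] at this
    · have h1 := min_le_right (c / (8 * M * K)) (g * √δ / 4)
      have h2 : 0 ≤ min (c / (8 * M * K)) (g * √δ / 4) := by positivity
      calc 16 * min (c / (8 * M * K)) (g * √δ / 4) ^ 2 ≤ 16 * (g * √δ / 4) ^ 2 := by gcongr
        _ = g ^ 2 * √δ ^ 2 := by ring
        _ = g ^ 2 * δ := by rw [Real.sq_sqrt hδ0.le]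
  obtain ⟨T, hT⟩ := Asymptotics.IsLittleO.exists_forall_le_mul hr
    (ε := q ^ 2 / ((K + 1) * (8 * σ ^ 2))) (by positivity)
  refine ⟨T, fun I X w v b h t ht m hKm hmt hreg => ?_⟩
  have hrR := hT t ht
  set R := q ^ 2 / ((K + 1) * (8 * σ ^ 2)) * t with hR
  have hR0 : 0 ≤ R := by positivity
  have hRq : (K + 1) * (8 * σ ^ 2 * R) = q ^ 2 * t := by rw [hR]; field_simp
  have ht0 : (0 : ℝ) < t := by exact_mod_cast (by omega : 0 < t)
  have hKt : K < t := by omega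
  have hbad := h.card_wrong_le hstar hM1.le hM hσ hsub le_rfl hq.le hR0 hKm hRq.le
    (fun s hs => hrR s (Finset.mem_Icc.1 hs).2) hreg
  have hcard : (((Finset.Icc m t).filter fun s => b s = star).card : ℝ)
      + ((Finset.Icc m t).filter fun s => b s ≠ star).card = t + 1 - m := by
    have h1 := Finset.card_filter_add_card_filter_not (s := Finset.Icc m t) (fun s => b s = star)
    rw [Nat.card_Icc] at h1
    rw [← Nat.cast_add, h1, Nat.cast_sub (by omega)]
    push_cast
    rfl
  have hmt' : 4 * (m : ℝ) ≤ t := by exact_mod_cast hmt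
  -- At least 3t/4 rounds are considered, of which at most t/4 are wrong.
  have hgood : (t : ℝ) / 2 ≤ ((Finset.Icc m t).filter fun s => b s = star).card := by
    have h1 : (((Finset.Icc m t).filter fun s => b s ≠ star).card : ℝ) ≤ t / 4 := by
      rw [← hc_def] at hbad
      have h2 : c * ((Finset.Icc m t).filter fun s => b s ≠ star).card ≤ c * (t / 4) :=
        hbad.trans (by nlinarith)
      exact le_of_mul_le_mul_left h2 hc
    linarith
  have hμt := hreg t (Finset.mem_Icc.2 ⟨by omega, le_rfl⟩)
  have hclose : ∀ a, a = star ∨ a ∈ neighbors star → |v t a - μ a| < g / 2 := by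
    intro a ha
    have h1 := h.mul_card_right_le hK hstar hM1.le hM hD hD0.le le_rfl hKm hreg ha
    have h2 := (h.sum_weights_mul_sq_le hσ hsub hKt hR0 (hrR t le_rfl) hμt a).trans hRq.le
    have h3 : δ * (t / 2) ≤ ∑ s ∈ Finset.Icc 1 t, w s a := by
      rw [hδ, div_mul_eq_mul_div, div_le_iff₀ (by positivity), mul_comm _ (M * D)]
      exact le_trans (by gcongr) h1
    have h4 : δ * (t / 2) * (v t a - μ a) ^ 2 ≤ q ^ 2 * t :=
      (mul_le_mul_of_nonneg_right h3 (sq_nonneg _)).trans h2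
    have h5 : δ * (v t a - μ a) ^ 2 ≤ 2 * q ^ 2 := by
      have : δ * (v t a - μ a) ^ 2 * t ≤ 2 * q ^ 2 * t := by linarith
      exact le_of_mul_le_mul_right this ht0
    refine abs_lt_of_sq_lt_sq ?_ (by positivity)
    have h6 : δ * (v t a - μ a) ^ 2 < δ * (g / 2) ^ 2 := by
      have : 0 < g ^ 2 * δ := by positivity
      nlinarith
    exact lt_of_mul_lt_mul_left h6 hδ0.le
  -- A wrong peak gives a neighbour i with v star ≤ v i, but two errors below g/2 cannot close the
  -- gap g.
  by_contra hne
  obtain ⟨i, hi, hle⟩ := (h.optimistic_mem t hKt ⟨μ, hμt⟩).2.exists_neighbor_le (Ne.symm hne)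
  have h1 := abs_lt.1 (hclose star (Or.inl rfl))
  have h2 := abs_lt.1 (hclose i (Or.inr hi))
  have h3 := hgap i (ne_of_mem_neighbors hi)
  linarith

/-! ### Stabilisation of pulls and measurability -/

theorem Monotone.exists_forall_ge_eq_of_le {g : ℕ → ℕ} (hg : Monotone g) {B : ℕ}
    (hB : ∀ n, g n ≤ B) : ∃ T, ∀ t ≥ T, g t = g T := by
  have hbdd : BddAbove (Set.range g) := ⟨B, by rintro _ ⟨n, rfl⟩; exact hB n⟩
  obtain ⟨T, hT⟩ := Nat.sSup_mem (Set.range_nonempty g) hbdd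
  exact ⟨T, fun t ht => le_antisymm (hT ▸ le_csSup hbdd ⟨t, rfl⟩) (hg ht)⟩

/-- Arms whose weights vanish from some round on are pulled finitely often. -/
theorem IsOTaSRun.exists_pulls_eq {K : ℕ} {F : ExpFamily} {r : ℕ → ℝ} {I : ℕ → Fin K}
    {X : ℕ → ℝ} {w v : ℕ → Fin K → ℝ} {b : ℕ → Fin K} (h : IsOTaSRun F r I X w v b)
    {S : Set (Fin K)} {T₁ : ℕ} (hw : ∀ t ≥ T₁, ∀ a ∈ S, w t a = 0) :
    ∃ T, ∀ t ≥ T, ∀ a ∈ S, pulls I a t = pulls I a T := by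
  have hone : ∀ a, ∃ T, a ∈ S → ∀ t ≥ T, pulls I a t = pulls I a T := by
    intro a
    by_cases ha : a ∈ S
    · have hW : ∀ t, ∑ s ∈ Finset.Icc 1 t, w s a ≤ T₁ := by
        intro t
        induction t with
        | zero => simp
        | succ t ih =>
          rcases le_or_gt T₁ (t + 1) with hle | hlt
          · rw [Finset.sum_Icc_succ_top (by omega), hw (t + 1) hle a ha, add_zero]
            exact ih
          · exact (h.sum_weights_le (t + 1) a).trans (by exact_mod_cast hlt.le)
      obtain ⟨T, hT⟩ := (pulls_mono I a).exists_forall_ge_eq_of_le (B := T₁ + 1) fun t => by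
        have : (pulls I a t : ℝ) ≤ T₁ + 1 := by
          linarith [h.pulls_le_sum_weights_add_one t a, hW t]
        exact_mod_cast this
      exact ⟨T, fun _ => hT⟩
    · exact ⟨0, fun hS => absurd hS ha⟩
  choose T hT using hone
  refine ⟨Finset.univ.sup T, fun t ht a ha => ?_⟩
  have hle : T a ≤ Finset.univ.sup T := Finset.le_sup (Finset.mem_univ a)
  rw [hT a ha t (hle.trans ht), hT a ha _ hle]

theorem measurable_pulls {K : ℕ} {Ω : Type*} [MeasurableSpace Ω] {I : ℕ → Ω → Fin K}
    (hI : ∀ t, Measurable (I (t + 1))) (a : Fin K) (t : ℕ) :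
    Measurable fun ω => pulls (fun s => I s ω) a t := by
  simp only [pulls, Finset.card_filter]
  refine Finset.measurable_sum _ fun s hs => ?_
  obtain ⟨s, rfl⟩ := Nat.exists_eq_add_of_le' (Finset.mem_Ico.1 hs).1
  exact Measurable.ite (hI s (measurableSet_singleton a)) measurable_const measurable_const

/-- A measurable selection of an integer among those that satisfy a measurable property. -/
theorem exists_measurable_forall_exists_imp {Ω : Type*} [MeasurableSpace Ω] {p : Ω → ℕ → Prop}
    (hp : ∀ n, MeasurableSet {ω | p ω n}) :
    ∃ T : Ω → ℕ, Measurable T ∧ ∀ ω, (∃ n, p ω n) → p ω (T ω) := by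
  classical
  -- The second alternative makes `Nat.find` total, returning 0 where no integer works.
  have hex : ∀ ω, ∃ n, p ω n ∨ ¬ ∃ k, p ω k := fun ω => by
    by_cases h : ∃ k, p ω k
    · exact h.imp fun _ hn => Or.inl hn
    · exact ⟨0, Or.inr h⟩
  refine ⟨fun ω => Nat.find (hex ω), measurable_find hex fun n => ?_, fun ω hω =>
    (Nat.find_spec (hex ω)).resolve_right (not_not_intro hω)⟩
  have h : {ω | ∃ k, p ω k} = ⋃ k, {ω | p ω k} := by ext; simp
  have hex_meas : MeasurableSet {ω | ∃ k, p ω k} := h ▸ MeasurableSet.iUnion hp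
  exact (hp n).union hex_meas.compl

theorem tsum_ofReal_mul_log_div_cube_ne_top {γ : ℝ} (hγ : 0 ≤ γ) :
    ∑' n : ℕ, ENNReal.ofReal (γ * Real.log n / (n : ℝ) ^ 3) ≠ ⊤ := by
  refine Summable.tsum_ofReal_ne_top (Summable.of_nonneg_of_le (fun n => ?_) (fun n => ?_)
    ((Real.summable_one_div_nat_pow (p := 2)).2 (by norm_num) |>.mul_left γ))
  · have := Real.log_natCast_nonneg n
    positivity
  · rcases Nat.eq_zero_or_pos n with rfl | hn
    · simp
    · have hn' : (0 : ℝ) < n := by exact_mod_cast hn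
      rw [mul_one_div, div_le_div_iff₀ (by positivity) (by positivity)]
      calc γ * Real.log n * (n : ℝ) ^ 2 ≤ γ * n * (n : ℝ) ^ 2 := by
            gcongr
            exact Real.log_le_self hn'.le
        _ = γ * (n : ℝ) ^ 3 := by ring

/-! ### The two conclusions -/

theorem mainTheorem7 {K : ℕ} (F : ExpFamily) (μ : Fin K → ℝ) (star : Fin K)
    (hμ : ∀ i, μ i ∈ F.means) (hstar : UnimodalAt μ star)
    (hbounded : ∃ M : ℝ, ∀ m ∈ F.means, ∀ m' ∈ F.means, |F.natParam m - F.natParam m'| ≤ M)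
    (hsubG : ∃ σ : ℝ, 0 < σ ∧
      ∀ m ∈ F.means, ∀ m' ∈ F.means, (m' - m) ^ 2 / (2 * σ ^ 2) ≤ F.kl m m')
    (f : ℕ → ℝ) (hf_nonneg : ∀ n, 0 ≤ f n) (hf_mono : Monotone f)
    (r : ℕ → ℝ) (hfr : ∀ t, f t ≤ r t)
    (hr : Asymptotics.IsLittleO atTop r (fun n : ℕ => (n : ℝ))) :
    ((∀ t, f (t ^ 2) ≤ r t) →
      ∃ T₀ : ℕ, ∀ (I : ℕ → Fin K) (X : ℕ → ℝ) (w v : ℕ → Fin K → ℝ) (b : ℕ → Fin K),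
        IsOTaSRun F r I X w v b →
        ∀ t ≥ T₀, Concentrated F μ f I X t →
          b t = star ∧ ∀ a, a ≠ star → a ∉ neighbors star → w t a = 0) ∧
    (∀ (Ω : Type*) (mΩ : MeasurableSpace Ω) (P : Measure Ω) (_ : IsProbabilityMeasure P)
      (ℱ : Filtration ℕ mΩ) (I : ℕ → Ω → Fin K) (X : ℕ → Ω → ℝ)
      (w v : Ω → ℕ → Fin K → ℝ) (b : Ω → ℕ → Fin K),
      IsBanditProcess F μ P ℱ I X →
      (∀ ω, IsOTaSRun F r (fun t => I t ω) (fun t => X t ω) (w ω) (v ω) (b ω)) →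
      (∃ γ : ℝ, 0 < γ ∧ ∀ n : ℕ,
        P {ω | ¬ Concentrated F μ f (fun t => I t ω) (fun t => X t ω) n} ≤
          ENNReal.ofReal (γ * Real.log n / (n : ℝ) ^ 3)) →
      (∀ᵐ ω ∂P, ∀ᶠ n in atTop, Concentrated F μ f (fun t => I t ω) (fun t => X t ω) n) ∧
      ∃ T : Ω → ℕ, Measurable T ∧
        ∀ ω, (∀ᶠ n in atTop, Concentrated F μ f (fun t => I t ω) (fun t => X t ω) n) →
          ∀ t ≥ T ω, ∀ a, a ≠ star → a ∉ neighbors star →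
            pulls (fun s => I s ω) a t = pulls (fun s => I s ω) a (T ω)) := by
  obtain ⟨T₀, hT₀⟩ := exists_optimistic_arm_eq F μ star hμ hstar hbounded hsubG r hr
  have hregion : ∀ (I : ℕ → Fin K) (X : ℕ → ℝ) (n s : ℕ), s ≤ n → f n ≤ r s →
      Concentrated F μ f I X n → μ ∈ structuredRegion F r I X s := fun I X n s hsn hfs hE =>
    ⟨fun i => ⟨hμ i, (hE i s hsn).trans (ENNReal.ofReal_le_ofReal hfs)⟩, star, hstar⟩
  have hweight : ∀ (I : ℕ → Fin K) (X : ℕ → ℝ) (w v : ℕ → Fin K → ℝ) (b : ℕ → Fin K),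
      IsOTaSRun F r I X w v b → ∀ t, K < t → μ ∈ structuredRegion F r I X t → b t = star →
      ∀ a, a ≠ star → a ∉ neighbors star → w t a = 0 := by
    intro I X w v b h t ht hreg hbt
    have := (h.weights_mem t ht ⟨μ, hreg⟩).2
    rwa [hbt] at this
  -- From t ≥ 36 on, 4(⌊√t⌋ + 1) ≤ t, so the rounds beyond √t cover the required three quarters.
  refine ⟨fun hf2 => ⟨max T₀ (max 36 (4 * (K + 1))), fun I X w v b h t ht hE => ?_⟩, ?_⟩
  · simp only [ge_iff_le, max_le_iff] at ht
    obtain ⟨ht0, ht36, htK⟩ := ht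
    have hsqrt : 4 * (Nat.sqrt t + 1) ≤ t := by
      have h1 : 6 ≤ Nat.sqrt t := Nat.le_sqrt.2 (by omega)
      have h2 := Nat.sqrt_le t
      nlinarith
    have hreg : ∀ s ∈ Finset.Icc (max (K + 1) (Nat.sqrt t + 1)) t,
        μ ∈ structuredRegion F r I X s := by
      intro s hs
      obtain ⟨hs1, hs2⟩ := Finset.mem_Icc.1 hs
      have hts : t ≤ s ^ 2 := by
        have := Nat.sqrt_lt.1 (lt_of_lt_of_le (Nat.lt_succ_self _) ((le_max_right _ _).trans hs1))
        rw [sq]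
        exact this.le
      exact hregion I X t s hs2 ((hf_mono hts).trans (hf2 s)) hE
    have hbt := hT₀ I X w v b h t ht0 _ (lt_of_lt_of_le (Nat.lt_succ_self K) (le_max_left _ _))
      (by omega) hreg
    exact ⟨hbt, hweight I X w v b h t (by omega)
      (hreg t (Finset.mem_Icc.2 ⟨by omega, le_rfl⟩)) hbt⟩
  · intro Ω mΩ P _ ℱ I X w v b hproc hrun hγ
    refine ⟨?_, ?_⟩
    · obtain ⟨γ, hγ, hP⟩ := hγ
      have := ae_eventually_notMem (μ := P)
        (s := fun n => {ω | ¬ Concentrated F μ f (fun t => I t ω) (fun t => X t ω) n})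
        (ne_top_of_le_ne_top (tsum_ofReal_mul_log_div_cube_ne_top hγ.le)
          (ENNReal.tsum_le_tsum hP))
      filter_upwards [this] with ω hω
      filter_upwards [hω] with n hn
      exact not_not.1 hn
    -- T is selected through the pull counts alone, so measurability of the concentration events is
    -- not needed.
    · obtain ⟨T, hTm, hT⟩ := exists_measurable_forall_exists_imp
        (p := fun ω n => ∀ t ≥ n, ∀ a ∈ {a | a ≠ star ∧ a ∉ neighbors star},
          pulls (fun s => I s ω) a t = pulls (fun s => I s ω) a n) (fun n => by
          have hI : ∀ t, Measurable (I (t + 1)) := fun t =>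
            (hproc.arm_measurable t).mono (ℱ.le t) le_rfl
          have : {ω | ∀ t ≥ n, ∀ a ∈ {a | a ≠ star ∧ a ∉ neighbors star},
              pulls (fun s => I s ω) a t = pulls (fun s => I s ω) a n}
              = ⋂ t ≥ n, ⋂ a ∈ {a | a ≠ star ∧ a ∉ neighbors star},
                {ω | pulls (fun s => I s ω) a t = pulls (fun s => I s ω) a n} := by
            ext ω
            simp only [Set.mem_iInter]
            rfl
          rw [this]
          exact MeasurableSet.iInter fun t => MeasurableSet.iInter fun _ =>
            MeasurableSet.iInter fun a => MeasurableSet.iInter fun _ =>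
              measurableSet_eq_fun (measurable_pulls hI a t) (measurable_pulls hI a n))
      refine ⟨T, hTm, fun ω hω t ht a ha ha' => hT ω ?_ t ht a ⟨ha, ha'⟩⟩
      obtain ⟨n₀, hn₀⟩ := eventually_atTop.1 hω
      have hreg : ∀ s ≥ n₀, μ ∈ structuredRegion F r (fun t => I t ω) (fun t => X t ω) s :=
        fun s hs => hregion _ _ s s le_rfl (hfr s) (hn₀ s hs)
      refine (hrun ω).exists_pulls_eq (T₁ := max T₀ (4 * max (K + 1) n₀)) fun t ht a ha => ?_
      simp only [ge_iff_le, max_le_iff] at ht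
      have hbt := hT₀ _ _ _ _ _ (hrun ω) t ht.1 (max (K + 1) n₀) (by omega) ht.2
        fun s hs => hreg s (by have := (Finset.mem_Icc.1 hs).1; omega)
      exact hweight _ _ _ _ _ (hrun ω) t (by omega) (hreg t (by omega)) hbt a ha.1 ha.2
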